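/- Fix a trading rate $v>0$, a duration $T>0$, a volatility $\sigma>0$, an initial price $S_0$ and an integer $N\ge 1$, and put $\Delta t=T/N$, $t_i=i\Delta t$ for $1\le i\le N$. For a parameter $\theta=(\theta_f,\theta_G)\in\Theta=\Theta_f\times\Gamma$ ($\Theta_f\neq\emptyset$, $\Gamma\subseteq\mathbb R$) consider the propagator model $$S_t=S_0+\int_0^t f(v;\theta_f)\,G(t-s;\theta_G)\,ds+\sigma W_t,$$ where $W$ is a standard Brownian motion, the instantaneous impact function $f$ satisfies $f(x;\theta_f)\neq 0$ for all $x>0$ and $\theta_f\in\Theta_f$, and the parametrization is separable, that is, $f$ depends only on $\theta_f$ and the decay kernel $G$ only on $\theta_G$. Assume that $\Gamma$ contains a nonempty open set and that, with constants $c\neq 0$ and $l_0>0$ not depending on the parameter, one of the following holds: 1. $\Gamma\subseteq(0,1)$ and $G(s;\gamma)=c\,s^{-\gamma}$ for $s>0$ and $\gamma\in\Gamma$; 2. $\Gamma\subseteq(0,1)$ and $G(s;\gamma)=c\,l_0(l_0+s)^{-\gamma}$ for $s>0$ and $\gamma\in\Gamma$; 3. $\Gamma\subseteq(0,\infty)$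 and $G(s;\rho)=c\,e^{-\rho s}$ for $s>0$ and $\rho\in\Gamma$. Consider the statistical experiment in which the full grid trajectory $\boldsymbol S_{\mathrm{full}}=(S_{t_1},\dots,S_{t_N})\in\mathbb R^N$ is observed. A statistic $Y$, that is, a measurable function of $\boldsymbol S_{\mathrm{full}}$ with values in a measurable space, is called sufficient if the conditional distribution of $\boldsymbol S_{\mathrm{full}}$ given $Y$ is free of $\theta$, and a sufficient statistic is called minimal sufficient if it is a measurable function of every other sufficient statistic, almost surely under every $\theta\in\Theta$. Then $\boldsymbol S_{\mathrm{full}}$ is minimal sufficient. It is moreover the unique sufficient statistic up to a one-to-one transformation: a statistic $Y$ is sufficient if and only if $Y$ and $\boldsymbol S_{\mathrm{full}}$ are measurable functions of each other, almost surely under every $\theta\in\Theta$. -/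

import Mathlib

open MeasureTheory ProbabilityTheory Set
open scoped NNReal

universe u v w

/-! ### Sufficiency and minimal sufficiency -/

/-- A statistic `Y` on the sample space `𝒳` is sufficient for the statistical experiment
`(Q θ)_θ` if it is measurable and the conditional distribution of the sample given `Y` is free
of `θ`: one Markov kernel is a conditional distribution of the sample given `Y` under every
`Q θ`. -/
def IsSufficientStatistic {Θ 𝒳 E : Type*} [MeasurableSpace 𝒳] [MeasurableSpace E]
    (Q : Θ → Measure 𝒳) (Y : 𝒳 → E) : Prop :=
  Measurable Y ∧
    ∃ κ : Kernel E 𝒳, IsMarkovKernel κ ∧ ∀ θ, HasCondDistrib (fun x : 𝒳 => x) Y κ (Q θ)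

/-- A statistic `X` is minimal sufficient if it is sufficient and is a (measurable) function of
every other sufficient statistic `Y`, almost everywhere under every `Q θ`. -/
def IsMinimalSufficientStatistic {Θ 𝒳 E : Type*} [MeasurableSpace 𝒳] [MeasurableSpace E]
    (Q : Θ → Measure 𝒳) (X : 𝒳 → E) : Prop :=
  IsSufficientStatistic Q X ∧
    ∀ (F : Type u) [MeasurableSpace F] (Y : 𝒳 → F), IsSufficientStatistic Q Y →
      ∃ g : F → E, Measurable g ∧ ∀ θ, ∀ᵐ x ∂(Q θ), X x = g (Y x)

/-- Two statistics are one-to-one transformations of each other: almost everywhere under every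
`Q θ`, each of them is a (measurable) function of the other. -/
def IsOneToOneTransform {Θ 𝒳 E F : Type*} [MeasurableSpace 𝒳] [MeasurableSpace E]
    [MeasurableSpace F] (Q : Θ → Measure 𝒳) (X : 𝒳 → E) (Y : 𝒳 → F) : Prop :=
  ∃ (h : E → F) (g : F → E), Measurable h ∧ Measurable g ∧
    ∀ θ, ∀ᵐ x ∂(Q θ), Y x = h (X x) ∧ X x = g (Y x)

/-! ### Decay kernels

`G γ s` is the value at time `s` of the decay kernel with parameter `γ`; only its values at
`s > 0` matter. The constant of proportionality `c` does not vary with the parameter. -/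

/-- The family `G γ s ∝ s ^ (-γ)` with `γ` ranging over `Γ ⊆ (0, 1)`. -/
def IsPowerLawKernel (Γ : Set ℝ) (G : ℝ → ℝ → ℝ) : Prop :=
  Γ ⊆ Ioo 0 1 ∧ ∃ c : ℝ, c ≠ 0 ∧ ∀ γ ∈ Γ, ∀ s : ℝ, 0 < s → G γ s = c * s ^ (-γ)

/-- The family `G γ s ∝ l₀ (l₀ + s) ^ (-γ)` with `l₀ > 0` fixed and `γ` ranging over
`Γ ⊆ (0, 1)`. -/
def IsShiftedPowerLawKernel (Γ : Set ℝ) (G : ℝ → ℝ → ℝ) : Prop :=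
  Γ ⊆ Ioo 0 1 ∧ ∃ l₀ : ℝ, 0 < l₀ ∧ ∃ c : ℝ, c ≠ 0 ∧
    ∀ γ ∈ Γ, ∀ s : ℝ, 0 < s → G γ s = c * (l₀ * (l₀ + s) ^ (-γ))

/-- The family `G ρ s ∝ exp (-ρ s)` with `ρ` ranging over `Γ ⊆ (0, ∞)`. -/
def IsExponentialKernel (Γ : Set ℝ) (G : ℝ → ℝ → ℝ) : Prop :=
  Γ ⊆ Ioi 0 ∧ ∃ c : ℝ, c ≠ 0 ∧ ∀ ρ ∈ Γ, ∀ s : ℝ, 0 < s → G ρ s = c * Real.exp (-ρ * s)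

/-! ### The propagator model -/

/-- The price `S_t = S₀ + ∫₀ᵗ f(v) G(t - s) ds + σ W_t` of the propagator model under trading at
the constant rate `v`. -/
noncomputable def propagatorPrice {Ω : Type*} (S₀ σ v : ℝ) (f G : ℝ → ℝ) (W : ℝ≥0 → Ω → ℝ)
    (t : ℝ≥0) (ω : Ω) : ℝ :=
  S₀ + (∫ s in (0 : ℝ)..(t : ℝ), f v * G ((t : ℝ) - s)) + σ * W t ω

/-- The grid points `t_i = i Δt`, `i = 1, …, N`, where `Δt = T / N`
(indexed from `0`, so that index `i` gives `t_{i+1}`). -/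
noncomputable def gridTime (T : ℝ≥0) (N : ℕ) (i : Fin N) : ℝ≥0 :=
  ((i : ℕ) + 1) * (T / N)

/-- The full grid trajectory `(S_{t_1}, …, S_{t_N})` of a price process. -/
noncomputable def fullTrajectory {Ω : Type*} (T : ℝ≥0) (N : ℕ) (S : ℝ≥0 → Ω → ℝ) (ω : Ω) :
    Fin N → ℝ :=
  fun i => S (gridTime T N i) ω

/-- The statistical experiment given by the full grid trajectory in the propagator model with
`f` and `G` separable: the parameter is `θ = (θ_f, θ_G) ∈ Θf × Γ`, the function `f` depends on
`θ_f` only and `G` on `θ_G` only, and the experiment associates with `θ` the law of the full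
trajectory on `ℝ ^ N` under `P θ`, where `W θ` is the driving noise. -/
noncomputable def fullExperiment {A Ω : Type*} [MeasurableSpace Ω] (Θf : Set A) (Γ : Set ℝ)
    (f : A → ℝ → ℝ) (G : ℝ → ℝ → ℝ) (S₀ σ v : ℝ) (T : ℝ≥0) (N : ℕ)
    (P : A × ℝ → Measure Ω) (W : A × ℝ → ℝ≥0 → Ω → ℝ) (θ : ↥(Θf ×ˢ Γ)) :
    Measure (Fin N → ℝ) :=
  (P θ.1).map (fullTrajectory T N (propagatorPrice S₀ σ v (f θ.1.1) (G θ.1.2) (W θ.1)))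

/-!
# Minimal sufficiency of the full price trajectory

Since trading is at a constant rate, the price at the grid points is a deterministic mean vector
`m θ` plus `σ` times a Brownian motion sampled on the grid. The experiment therefore consists of
translates `ν.map (· + m θ)` of a single Gaussian measure `ν` on `ℝ ^ N`, whose covariance matrix
`C` is proportional to `min (i + 1) (j + 1)` and hence invertible.

By the Cameron-Martin formula (`map_add_const_eq_tilted_dotProduct`), the law for `θ` has density
proportional to `exp ⟪C⁻¹ (m θ - m θ₀), x⟫` with respect to the law for `θ₀`. If `Y` is sufficient,
this density is almost everywhere a function of `Y`
(`IsSufficientStatistic.exists_eq_withDensity_comp`, the necessity half of the factorization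
criterion), and so is the linear functional `⟪C⁻¹ (m θ - m θ₀), ·⟫`. The functionals which are
almost everywhere functions of `Y` form a linear subspace. If the differences `m θ - m θ₀` span
`ℝ ^ N`, this subspace contains every coordinate, and the whole trajectory is a function of `Y`
(`IsSufficientStatistic.exists_eq_comp_of_gaussian_shift`).

The spanning property needs only the variation of the decay parameter, with `θ_f` fixed. A linear
functional annihilating all differences gives weights `w` for which `∑ i, w i * m θ i` is constant
on an open set of decay parameters. The integrals of the three families of kernels are explicit:
they turn this relation into one between exponentials `x ↦ exp (l i * x)` with distinct
frequencies and a linear function of `x`, and this forces `w = 0`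
(`eq_zero_of_sum_integral_kernel_eq_const`).
-/

/-! ### Translates of Gaussian measures -/

section
variable {E : Type*} [NormedAddCommGroup E] [NormedSpace ℝ E] [MeasurableSpace E]

lemma ProbabilityTheory.IsGaussian.integral_exp_dual (μ : Measure E) [IsGaussian μ]
    (L : StrongDual ℝ E) :
    ∫ x, Real.exp (L x) ∂μ = Real.exp ((∫ x, L x ∂μ) + Var[L; μ] / 2) := by
  have h := mgf_gaussianReal (IsGaussian.map_eq_gaussianReal (μ := μ) L) 1
  simpa [mgf, Real.coe_toNNReal _ (variance_nonneg _ _)] using h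

lemma ProbabilityTheory.IsGaussian.integrable_exp_dual (μ : Measure E) [IsGaussian μ]
    (L : StrongDual ℝ E) :
    Integrable (fun x => Real.exp (L x)) μ := by
  by_contra h
  have := IsGaussian.integral_exp_dual μ L
  rw [integral_undef h] at this
  exact (Real.exp_pos _).ne this

/-- The **Cramér-Wold device**: a finite measure is determined by its one-dimensional projections. -/
lemma MeasureTheory.Measure.ext_of_map_dual [BorelSpace E] [CompleteSpace E]
    [SecondCountableTopology E] {μ ν : Measure E} [IsFiniteMeasure μ] [IsFiniteMeasure ν]
    (h : ∀ L : StrongDual ℝ E, μ.map L = ν.map L) : μ = ν := by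
  refine Measure.ext_of_charFunDual (funext fun L => ?_)
  rw [charFunDual_eq_charFun_map_one, charFunDual_eq_charFun_map_one, h]

/-- The **Cameron-Martin formula**: if the functional `L` represents `h` through the covariance of
the Gaussian measure `μ`, then translating `μ` by `h` amounts to weighting it with the density
`exp L`, normalized. Both measures have the same one-dimensional projections, because the moment
generating functions of these agree. -/
theorem ProbabilityTheory.IsGaussian.map_add_const_eq_tilted [BorelSpace E] [CompleteSpace E]
    [SecondCountableTopology E] (μ : Measure E) [IsGaussian μ] (h : E) (L : StrongDual ℝ E)
    (hL : ∀ L' : StrongDual ℝ E, cov[L, L'; μ] = L' h) :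
    μ.map (· + h) = μ.tilted L := by
  have hint := IsGaussian.integrable_exp_dual μ L
  have := isProbabilityMeasure_tilted hint
  have : IsProbabilityMeasure (μ.map (· + h)) :=
    Measure.isProbabilityMeasure_map (by fun_prop)
  refine Measure.ext_of_map_dual fun L' => ?_
  have hmgf : mgf L' (μ.map (· + h)) = mgf L' (μ.tilted L) := by
    ext s
    have h1 : mgf L' (μ.tilted L) s = ∫ x, Real.exp ((s • L') x) ∂(μ.tilted L) := rfl
    have h2 : mgf L' (μ.map (· + h)) s = Real.exp (s * L' h) * ∫ x, Real.exp ((s • L') x) ∂μ := by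
      rw [mgf, integral_map (by fun_prop) (by fun_prop), ← integral_const_mul]
      refine integral_congr_ae (.of_forall fun x => ?_)
      simp only [map_add, smul_apply, smul_eq_mul]
      rw [← Real.exp_add]; ring_nf
    rw [h1, h2, integral_exp_tilted, ← FunLike.coe_add,
      IsGaussian.integral_exp_dual, IsGaussian.integral_exp_dual, IsGaussian.integral_exp_dual,
      ← Real.exp_add, ← Real.exp_sub]
    congr 1
    have m1 := IsGaussian.memLp_dual μ L 2 (by simp)
    have m2 := IsGaussian.memLp_dual μ (s • L') 2 (by simp)
    rw [FunLike.coe_add, variance_add m1 m2]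
    have hc : cov[L, (s • L' : StrongDual ℝ E); μ] = s * L' h := by rw [hL]; simp
    have hs : ∫ x, (⇑L + ⇑(s • L')) x ∂μ = ∫ x, L x ∂μ + ∫ x, (s • L') x ∂μ :=
      integral_add (IsGaussian.integrable_dual μ L) (IsGaussian.integrable_dual μ (s • L'))
    rw [hc, hs]
    ring
  have hset : integrableExpSet L' (μ.map (· + h)) = univ := by
    refine eq_univ_of_forall fun s => ?_
    exact IsGaussian.integrable_exp_dual (μ.map (· + h)) (s • L')
  refine Measure.ext_of_complexMGF_eq (by fun_prop) (by fun_prop) (funext fun z => ?_)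
  exact eqOn_complexMGF_of_mgf hmgf (by simp [hset])

end

/-! ### Sufficient statistics -/

section
variable {Θ 𝒳 F : Type*} [MeasurableSpace 𝒳] [MeasurableSpace F]
  {Q : Θ → Measure 𝒳}

lemma IsOneToOneTransform.isSufficientStatistic [∀ θ, IsProbabilityMeasure (Q θ)] {Y : 𝒳 → F}
    (hY : Measurable Y) (h : IsOneToOneTransform Q (fun x : 𝒳 => x) Y) :
    IsSufficientStatistic Q Y := by
  obtain ⟨_, g, -, hg, hae⟩ := h
  refine ⟨hY, Kernel.deterministic g hg, inferInstance, fun θ => ⟨by fun_prop, ?_⟩⟩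
  rw [Measure.compProd_deterministic, Measure.map_map (by fun_prop) hY]
  refine Measure.map_congr ?_
  filter_upwards [hae θ] with x hx
  simp [← hx.2]

lemma isSufficientStatistic_id [∀ θ, IsProbabilityMeasure (Q θ)] :
    IsSufficientStatistic Q (fun x : 𝒳 => x) :=
  IsOneToOneTransform.isSufficientStatistic measurable_id
    ⟨id, id, measurable_id, measurable_id, fun _ => .of_forall fun _ => ⟨rfl, rfl⟩⟩

/-- Necessity in the **factorization criterion**: for a sufficient statistic `Y`, the density of
`Q θ` with respect to `Q θ₀` can be chosen to be a function of `Y`, namely the density of the law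
of `Y`. No regularity of the space `F` is needed, since the common conditional distribution is part
of the definition of sufficiency. -/
theorem IsSufficientStatistic.exists_eq_withDensity_comp [∀ θ, IsProbabilityMeasure (Q θ)]
    {Y : 𝒳 → F} (hY : IsSufficientStatistic Q Y) (θ₀ θ : Θ) (hac : Q θ ≪ Q θ₀) :
    ∃ q : F → ENNReal, Measurable q ∧ Q θ = (Q θ₀).withDensity (q ∘ Y) := by
  obtain ⟨hYm, κ, hκ, hcond⟩ := hY
  have hp (θ) : IsProbabilityMeasure ((Q θ).map Y) :=
    Measure.isProbabilityMeasure_map hYm.aemeasurable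
  have hac' : (Q θ).map Y ≪ (Q θ₀).map Y := hac.map hYm
  set q := ((Q θ).map Y).rnDeriv ((Q θ₀).map Y) with hq
  have hqm : Measurable q := Measure.measurable_rnDeriv _ _
  have hdens : ((Q θ₀).map Y).withDensity q = (Q θ).map Y :=
    Measure.withDensity_rnDeriv_eq _ _ hac'
  refine ⟨q, hqm, Measure.ext fun s hs => ?_⟩
  have hκs : Measurable fun y => κ y s := κ.measurable_coe hs
  have h1 : Q θ s = ∫⁻ y, q y * κ y s ∂((Q θ₀).map Y) := by
    have h := congrArg (fun m => m (univ ×ˢ s)) (hcond θ).map_eq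
    simp only at h
    rw [Measure.map_apply (by fun_prop) (MeasurableSet.univ.prod hs),
      Measure.compProd_apply_prod MeasurableSet.univ hs, setLIntegral_univ, ← hdens,
      lintegral_withDensity_eq_lintegral_mul _ hqm hκs] at h
    simpa [mk_preimage_prod] using h
  have h2 : (Q θ₀).withDensity (q ∘ Y) s = ∫⁻ y, q y * κ y s ∂((Q θ₀).map Y) := by
    have hm : Measurable fun p : F × 𝒳 => q p.1 * s.indicator 1 p.2 :=
      (hqm.comp measurable_fst).mul ((measurable_one.indicator hs).comp measurable_snd)
    have h : ∫⁻ x, q (Y x) * s.indicator 1 x ∂(Q θ₀) = _ :=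
      (lintegral_map (μ := Q θ₀) hm (hYm.prodMk measurable_id)).symm
    have h' := (hcond θ₀).map_eq
    rw [show (fun x => (Y x, id x)) = fun x => (Y x, x) from rfl, h',
      Measure.lintegral_compProd hm] at h
    rw [withDensity_apply _ hs, ← lintegral_indicator hs]
    calc _ = ∫⁻ x, q (Y x) * s.indicator 1 x ∂(Q θ₀) := by
          refine lintegral_congr fun x => ?_
          by_cases hx : x ∈ s <;> simp [hx]
      _ = _ := h
      _ = _ := by
          refine lintegral_congr fun y => ?_
          simp only
          rw [lintegral_const_mul _ (measurable_one.indicator hs), lintegral_indicator_one hs]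
  rw [h1, h2]

end

/-! ### Sufficiency in a Gaussian shift experiment -/

section
open Matrix
variable {ι : Type*} [Fintype ι]

lemma covariance_dotProduct (μ : Measure (ι → ℝ)) [IsGaussian μ] {C : Matrix ι ι ℝ}
    (hcov : ∀ i j, cov[fun x => x i, fun x => x j; μ] = C i j) (a b : ι → ℝ) :
    cov[fun x => a ⬝ᵥ x, fun x => b ⬝ᵥ x; μ] = b ⬝ᵥ C *ᵥ a := by
  have hm (c : ι → ℝ) (i : ι) : MemLp (fun x : ι → ℝ => c i * x i) 2 μ :=
    (IsGaussian.memLp_dual μ (ContinuousLinearMap.proj i) 2 (by simp)).const_mul (c i)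
  simp only [dotProduct, mulVec]
  rw [covariance_fun_sum_fun_sum (hm a) (hm b), Finset.sum_comm]
  refine Finset.sum_congr rfl fun j _ => ?_
  rw [Finset.mul_sum]
  refine Finset.sum_congr rfl fun i _ => ?_
  rw [covariance_const_mul_left, covariance_const_mul_right, covariance_comm, hcov]
  ring

lemma covariance_map_add_const (μ : Measure (ι → ℝ)) [IsGaussian μ] (h : ι → ℝ) (i j : ι) :
    cov[fun x => x i, fun x => x j; μ.map (· + h)] = cov[fun x => x i, fun x => x j; μ] := by
  have hm (i : ι) : Integrable (fun x : ι → ℝ => x i) μ :=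
    IsGaussian.integrable_dual μ (ContinuousLinearMap.proj i)
  rw [covariance_map_fun (measurable_pi_apply i).aestronglyMeasurable
    (measurable_pi_apply j).aestronglyMeasurable (by fun_prop)]
  simp only [Pi.add_apply]
  rw [covariance_add_const_left (hm i), covariance_add_const_right (hm j)]

/-- The Cameron-Martin formula in coordinates, for a nondegenerate Gaussian measure. -/
theorem map_add_const_eq_tilted_dotProduct [DecidableEq ι] (μ : Measure (ι → ℝ)) [IsGaussian μ]
    {C : Matrix ι ι ℝ} (hC : IsUnit C.det)
    (hcov : ∀ i j, cov[fun x => x i, fun x => x j; μ] = C i j) (h : ι → ℝ) :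
    μ.map (· + h) = μ.tilted fun x => (C⁻¹ *ᵥ h) ⬝ᵥ x := by
  let D (a : ι → ℝ) : StrongDual ℝ (ι → ℝ) := ∑ i, a i • ContinuousLinearMap.proj i
  have hD (a : ι → ℝ) : ⇑(D a) = fun x => a ⬝ᵥ x := by
    ext x
    simp [D, dotProduct]
  have key := IsGaussian.map_add_const_eq_tilted μ h (D (C⁻¹ *ᵥ h)) fun L' => ?_
  · rw [key, hD]
  · have hL' : L' = D fun i => L' (fun j => if i = j then 1 else 0) := by
      ext x
      rw [hD]
      have := L'.toLinearMap.pi_apply_eq_sum_univ x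
      simpa [dotProduct, mul_comm] using this
    rw [hL', hD, hD, covariance_dotProduct μ hcov, mulVec_mulVec, mul_nonsing_inv _ hC, one_mulVec]

/-- The vectors `a` for which the linear functional `x ↦ a ⬝ᵥ x` is `μ`-almost everywhere a
measurable function of the statistic `Y`, as a subspace. -/
def measurableFunctionals {F : Type*} [MeasurableSpace F] (μ : Measure (ι → ℝ))
    (Y : (ι → ℝ) → F) : Submodule ℝ (ι → ℝ) where
  carrier := {a | ∃ φ : F → ℝ, Measurable φ ∧ ∀ᵐ x ∂μ, a ⬝ᵥ x = φ (Y x)}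
  zero_mem' := ⟨0, measurable_zero, by simp⟩
  add_mem' := by
    rintro a b ⟨φ, hφ, ha⟩ ⟨ψ, hψ, hb⟩
    refine ⟨φ + ψ, hφ.add hψ, ?_⟩
    filter_upwards [ha, hb] with x hx hx'
    simp [add_dotProduct, hx, hx']
  smul_mem' := by
    rintro c a ⟨φ, hφ, ha⟩
    refine ⟨c • φ, hφ.const_smul c, ?_⟩
    filter_upwards [ha] with x hx
    simp [hx]

/-- In the experiment of translates of a nondegenerate Gaussian measure by vectors `m θ` whose
differences span the space, the sample is a function of every sufficient statistic. -/
theorem IsSufficientStatistic.exists_eq_comp_of_gaussian_shift [DecidableEq ι] {Θ F : Type*}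
    [MeasurableSpace F]
    (ν : Measure (ι → ℝ)) [IsGaussian ν] {C : Matrix ι ι ℝ} (hC : IsUnit C.det)
    (hcov : ∀ i j, cov[fun x => x i, fun x => x j; ν] = C i j) {m : Θ → ι → ℝ} (θ₀ : Θ)
    (hspan : Submodule.span ℝ (range fun θ => m θ - m θ₀) = ⊤) {Y : (ι → ℝ) → F}
    (hY : IsSufficientStatistic (fun θ => ν.map (· + m θ)) Y) :
    ∃ g : F → ι → ℝ, Measurable g ∧ ∀ θ, ∀ᵐ x ∂(ν.map (· + m θ)), x = g (Y x) := by
  have hprob (θ) : IsProbabilityMeasure (ν.map (· + m θ)) := inferInstance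
  set μ := ν.map (· + m θ₀) with hμ
  have hcovμ (i j) : cov[fun x => x i, fun x => x j; μ] = C i j := by
    rw [hμ, covariance_map_add_const, hcov]
  have htilt (θ) : ν.map (· + m θ) = μ.tilted fun x => (C⁻¹ *ᵥ (m θ - m θ₀)) ⬝ᵥ x := by
    rw [← map_add_const_eq_tilted_dotProduct μ hC hcovμ, hμ,
      Measure.map_map (by fun_prop) (by fun_prop)]
    congr 1
    ext x
    simp
  have hac (θ) : ν.map (· + m θ) ≪ μ := htilt θ ▸ tilted_absolutelyContinuous _ _
  have hmem (θ) : C⁻¹ *ᵥ (m θ - m θ₀) ∈ measurableFunctionals μ Y := by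
    obtain ⟨q, hq, hdens⟩ := hY.exists_eq_withDensity_comp θ₀ θ (hac θ)
    have hZ : 0 < ∫ x, Real.exp ((C⁻¹ *ᵥ (m θ - m θ₀)) ⬝ᵥ x) ∂μ := by
      refine integral_exp_pos ?_
      by_contra hni
      have h0 := htilt θ
      rw [tilted_of_not_integrable hni] at h0
      exact IsProbabilityMeasure.ne_zero _ h0
    have hdot : Measurable fun x => (C⁻¹ *ᵥ (m θ - m θ₀)) ⬝ᵥ x :=
      Finset.measurable_sum _ fun i _ => (measurable_pi_apply i).const_mul _
    set Z := ∫ x, Real.exp ((C⁻¹ *ᵥ (m θ - m θ₀)) ⬝ᵥ x) ∂μ with hZdef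
    refine ⟨fun y => Real.log ((q y).toReal * Z), by fun_prop, ?_⟩
    -- The two expressions for the density of the law for `θ` agree almost everywhere.
    have hd : μ.withDensity (q ∘ Y) = μ.withDensity
        fun x => ENNReal.ofReal (Real.exp ((C⁻¹ *ᵥ (m θ - m θ₀)) ⬝ᵥ x) / Z) :=
      hdens.symm.trans (htilt θ)
    have hfin : ∫⁻ x, (q ∘ Y) x ∂μ ≠ ⊤ := by
      rw [← setLIntegral_univ, ← withDensity_apply _ MeasurableSet.univ, ← hdens]
      exact measure_ne_top _ _
    rw [withDensity_eq_iff (hq.comp hY.1).aemeasurable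
      (by fun_prop) hfin] at hd
    filter_upwards [hd] with x hx
    simp only [Function.comp_apply] at hx
    rw [hx, ENNReal.toReal_ofReal (by positivity), div_mul_cancel₀ _ hZ.ne', Real.log_exp]
  -- The vectors `h` with `C⁻¹ h` in the subspace contain a spanning set; take `h = C e_i`.
  have htop : ⊤ ≤ (measurableFunctionals μ Y).comap (C⁻¹).mulVecLin := by
    rw [← hspan, Submodule.span_le]
    rintro _ ⟨θ, rfl⟩
    exact hmem θ
  have hcoord (i : ι) : Pi.single i 1 ∈ measurableFunctionals μ Y := by
    have := htop (Submodule.mem_top (x := C *ᵥ Pi.single i 1))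
    rwa [Submodule.mem_comap, mulVecLin_apply, mulVec_mulVec, nonsing_inv_mul _ hC,
      one_mulVec] at this
  choose φ hφ hae using hcoord
  refine ⟨fun y i => φ i y, measurable_pi_lambda _ hφ, fun θ => (hac θ).ae_le ?_⟩
  filter_upwards [ae_all_iff.2 hae] with x hx
  ext i
  simpa using hx i

end

/-! ### Linear relations between exponentials -/

section
open Real

/-- Exponentials with distinct frequencies are distinct characters of `ℝ`, hence independent. -/
lemma linearIndependent_exp_mul {ι : Type*} {l : ι → ℝ} (hl : Function.Injective l) :
    LinearIndependent ℝ fun (i : ι) (x : ℝ) => exp (l i * x) := by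
  let χ : ι → (Multiplicative ℝ →* ℝ) := fun i =>
    { toFun := fun x => exp (l i * x.toAdd)
      map_one' := by simp
      map_mul' := fun x y => by simp [mul_add, exp_add] }
  have hχ : Function.Injective χ := fun i j hij => hl <| by
    have := DFunLike.congr_fun hij (Multiplicative.ofAdd (1 : ℝ))
    simpa [χ] using this
  exact (linearIndependent_monoidHom (Multiplicative ℝ) ℝ).comp χ hχ

/-- A combination of exponentials with distinct frequencies that is a multiple of `x` on a nonempty
open set is trivial; the frequency `0` is allowed. -/
theorem eq_zero_of_sum_exp_mul_eq_mul {ι : Type*} [Fintype ι] {l : ι → ℝ}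
    (hl : Function.Injective l) {V : Set ℝ} (hV : IsOpen V) (hne : V.Nonempty) {a : ι → ℝ} {K : ℝ}
    (h : ∀ x ∈ V, ∑ i, a i * exp (l i * x) = K * x) : a = 0 := by
  classical
  obtain ⟨x₀, hx₀⟩ := hne
  have hall : (fun x => ∑ i, a i * exp (l i * x)) = fun x => K * x := by
    refine AnalyticOnNhd.eq_of_eventuallyEq (𝕜 := ℝ) (z₀ := x₀) ?_ ?_ ?_
    · intro x _; fun_prop
    · intro x _; fun_prop
    · filter_upwards [hV.mem_nhds hx₀] with x hx using h x hx
  replace hall (x : ℝ) : ∑ i, a i * exp (l i * x) = K * x := congrFun hall x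
  -- A second difference removes the linear term, and multiplies the coefficient `a i` by
  -- `(exp (l i) - 1) ^ 2`, which vanishes only for the frequency `0`.
  have hli := Fintype.linearIndependent_iff.1 (linearIndependent_exp_mul hl)
    (fun i => a i * (exp (l i) - 1) ^ 2) (by
      ext x
      have e0 := hall x
      have e1 := hall (x + 1)
      have e2 := hall (x + 1 + 1)
      have : ∑ i, a i * (exp (l i) - 1) ^ 2 * exp (l i * x)
          = ∑ i, a i * exp (l i * (x + 1 + 1)) - 2 * ∑ i, a i * exp (l i * (x + 1))
            + ∑ i, a i * exp (l i * x) := by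
        rw [Finset.mul_sum, ← Finset.sum_sub_distrib, ← Finset.sum_add_distrib]
        refine Finset.sum_congr rfl fun i _ => ?_
        simp only [mul_add, mul_one, exp_add]
        ring
      simp only [Finset.sum_apply, Pi.smul_apply, smul_eq_mul, Pi.zero_apply]
      rw [this, e0, e1, e2]
      ring)
  have hz : ∀ i, l i ≠ 0 → a i = 0 := fun i hi => by
    have := hli i
    have h1 : exp (l i) - 1 ≠ 0 := sub_ne_zero.2 (by simpa using hi)
    simpa [h1] using this
  ext i
  by_cases hi : l i = 0
  -- All other coefficients vanish, and at `x = 0` the relation reads `a i = 0`.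
  · have h0 := hall 0
    rw [Finset.sum_eq_single i (fun j _ hj => by
      rw [hz j (fun hj0 => hj (hl (hj0.trans hi.symm))), zero_mul]) (by simp)] at h0
    simpa using h0
  · exact hz i hi

/-- A variant of `eq_zero_of_sum_exp_mul_eq_mul` for exponentials `exp (l i * x)` with a further
exponential `exp (l' * x)` subtracted. -/
theorem eq_zero_of_sum_exp_sub_exp_eq_mul {ι : Type*} [Fintype ι] {l : ι → ℝ}
    (hl : Function.Injective l) {l' : ℝ} (hl' : ∀ i, l i ≠ l') {V : Set ℝ} (hV : IsOpen V)
    (hne : V.Nonempty) {a : ι → ℝ} {K : ℝ}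
    (h : ∀ x ∈ V, ∑ i, a i * (exp (l i * x) - exp (l' * x)) = K * x) : a = 0 := by
  have := eq_zero_of_sum_exp_mul_eq_mul (ι := Option ι) (l := fun o => o.elim l' l)
    (a := fun o => o.elim (-∑ i, a i) a) (K := K) ?_ hV hne ?_
  · ext i; simpa using congrFun this (some i)
  · rintro (_ | i) (_ | j) hij
    · rfl
    · exact absurd hij.symm (hl' j)
    · exact absurd hij (hl' i)
    · exact congrArg some (hl hij)
  · intro x hx
    rw [← h x hx, Fintype.sum_option]
    simp only [Option.elim_none, Option.elim_some, mul_sub, Finset.sum_sub_distrib,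
      Finset.sum_mul, neg_mul]
    ring

/-! ### Integrals of the decay kernels -/

/-- A convolution integral over `[0, t]` depends only on the values of the kernel at positive times. -/
lemma integral_eq_of_eqOn_pos {g k : ℝ → ℝ} (hgk : ∀ s, 0 < s → g s = k s) (b t : ℝ) (ht : 0 ≤ t) :
    ∫ s in (0 : ℝ)..t, b * g (t - s) = b * ∫ s in (0 : ℝ)..t, k s := by
  rw [intervalIntegral.integral_comp_sub_left (fun s => b * g s), sub_self, sub_zero,
    intervalIntegral.integral_const_mul]
  congr 1
  exact intervalIntegral.integral_congr_Ioo_of_le ht fun s hs => hgk s hs.1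

theorem integral_rpow_neg {γ t : ℝ} (hγ : γ < 1) (ht : 0 < t) :
    ∫ s in (0 : ℝ)..t, s ^ (-γ) = exp (log t * (1 - γ)) / (1 - γ) := by
  rw [integral_rpow (Or.inl (by linarith)), Real.zero_rpow (by linarith),
    Real.rpow_def_of_pos ht]
  ring_nf

theorem integral_add_rpow_neg {l γ t : ℝ} (hl : 0 < l) (hγ : γ < 1) (ht : 0 < t) :
    ∫ s in (0 : ℝ)..t, (l + s) ^ (-γ)
      = (exp (log (l + t) * (1 - γ)) - exp (log l * (1 - γ))) / (1 - γ) := by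
  rw [intervalIntegral.integral_comp_add_left (fun s => s ^ (-γ)),
    integral_rpow (Or.inl (by linarith)), Real.rpow_def_of_pos (by linarith),
    Real.rpow_def_of_pos (by linarith)]
  ring_nf

theorem integral_exp_neg_mul {ρ t : ℝ} (hρ : ρ ≠ 0) :
    ∫ s in (0 : ℝ)..t, exp (-ρ * s) = -(exp (-t * ρ) - exp (0 * ρ)) / ρ := by
  rw [intervalIntegral.integral_comp_mul_left (fun s => exp s) (neg_ne_zero.2 hρ), integral_exp]
  simp
  field_simp
  ring_nf

/-- For each of the three families of decay kernels, no nontrivial combination of the accumulated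
impacts at distinct times is constant in the decay parameter on a nonempty open set. For the power
laws, the relation is one between exponentials in `x = 1 - γ` with frequencies `log (t i)`,
respectively `log (l₀ + t i)` and `log l₀`; for the exponential kernel it is one in `ρ` with
frequencies `-t i` and `0`. Clearing the denominator `x` turns the constant `K` into a linear
function. -/
theorem eq_zero_of_sum_integral_kernel_eq_const {ι : Type*} [Fintype ι] {Γ U : Set ℝ}
    (hU : IsOpen U) (hne : U.Nonempty) (hUΓ : U ⊆ Γ) {G : ℝ → ℝ → ℝ}
    (hG : IsPowerLawKernel Γ G ∨ IsShiftedPowerLawKernel Γ G ∨ IsExponentialKernel Γ G)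
    {t : ι → ℝ} (ht : ∀ i, 0 < t i) (hinj : Function.Injective t) {b : ℝ} (hb : b ≠ 0)
    {w : ι → ℝ} {K : ℝ}
    (h : ∀ γ ∈ U, ∑ i, w i * ∫ s in (0 : ℝ)..t i, b * G γ (t i - s) = K) : w = 0 := by
  have hrefl : IsOpen ((fun x : ℝ => 1 - x) ⁻¹' U) := hU.preimage (by fun_prop)
  have hreflne : ((fun x : ℝ => 1 - x) ⁻¹' U).Nonempty := by
    obtain ⟨γ, hγ⟩ := hne
    exact ⟨1 - γ, by simpa using hγ⟩
  rcases hG with ⟨hΓ, c, hc, hG⟩ | ⟨hΓ, l, hl, c, hc, hG⟩ | ⟨hΓ, c, hc, hG⟩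
  · refine eq_zero_of_sum_exp_mul_eq_mul (l := fun i => log (t i)) (K := K / (b * c)) ?_
      hrefl hreflne fun x hx => ?_
    · exact fun i j hij => hinj (log_injOn_pos (ht i) (ht j) hij)
    · have hx1 := hΓ (hUΓ hx)
      have hx0 : x ≠ 0 := by have := hx1.2; intro h0; simp [h0] at this
      rw [← h _ hx, Finset.sum_div, Finset.sum_mul]
      refine Finset.sum_congr rfl fun i _ => ?_
      rw [integral_eq_of_eqOn_pos (hG _ (hUΓ hx)) b _ (ht i).le,
        intervalIntegral.integral_const_mul, integral_rpow_neg hx1.2 (ht i), sub_sub_cancel]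
      field_simp
  · refine eq_zero_of_sum_exp_sub_exp_eq_mul (l := fun i => log (l + t i)) (l' := log l)
      (K := K / (b * c * l)) ?_ ?_ hrefl hreflne fun x hx => ?_
    · intro i j hij
      have hi := ht i
      have hj := ht j
      exact hinj (add_left_cancel
        (log_injOn_pos (show 0 < l + t i by linarith) (show 0 < l + t j by linarith) hij))
    · intro i hi
      have hti := ht i
      have := log_injOn_pos (show 0 < l + t i by linarith) hl hi
      linarith
    · have hx1 := hΓ (hUΓ hx)
      have hx0 : x ≠ 0 := by have := hx1.2; intro h0; simp [h0] at this
      rw [← h _ hx, Finset.sum_div, Finset.sum_mul]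
      refine Finset.sum_congr rfl fun i _ => ?_
      rw [integral_eq_of_eqOn_pos (hG _ (hUΓ hx)) b _ (ht i).le,
        intervalIntegral.integral_const_mul, intervalIntegral.integral_const_mul,
        integral_add_rpow_neg hl hx1.2 (ht i), sub_sub_cancel]
      field_simp
  · refine eq_zero_of_sum_exp_sub_exp_eq_mul (l := fun i => -t i) (l' := 0)
      (K := -K / (b * c)) ?_ ?_ hU hne fun x hx => ?_
    · exact fun i j hij => hinj (neg_injective hij)
    · exact fun i => neg_ne_zero.2 (ht i).ne'
    · have hx0 : x ≠ 0 := (hΓ (hUΓ hx)).ne'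
      rw [← h _ hx, neg_div, neg_mul, Finset.sum_div, Finset.sum_mul, ← Finset.sum_neg_distrib]
      refine Finset.sum_congr rfl fun i _ => ?_
      rw [integral_eq_of_eqOn_pos (hG _ (hUΓ hx)) b _ (ht i).le,
        intervalIntegral.integral_const_mul, integral_exp_neg_mul hx0]
      field_simp

end

/-! ### The propagator model on the grid -/

section
open Matrix

lemma isUnit_det_min_succ (N : ℕ) {a : ℝ} (ha : a ≠ 0) :
    IsUnit (Matrix.of fun i j : Fin N => a * min ((i : ℝ) + 1) ((j : ℝ) + 1)).det := by
  -- The matrix is `a` times `A * Aᵀ`, where `A` sums up the increments.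
  let A : Matrix (Fin N) (Fin N) ℝ := Matrix.of fun i k => if k ≤ i then 1 else 0
  have hA : A.det = 1 := by
    rw [det_of_isLowerTriangular]
    · simp [A]
    · intro i j hij
      have : i < j := hij
      simp [A, this]
  have hAA : (Matrix.of fun i j : Fin N => a * min ((i : ℝ) + 1) ((j : ℝ) + 1))
      = a • (A * Aᵀ) := by
    ext i j
    have hcard : (A * Aᵀ) i j = ((Finset.Iic (min i j)).card : ℝ) := by
      simp only [mul_apply, transpose_apply, A, of_apply, mul_ite, mul_one, mul_zero, ← ite_and]
      rw [Finset.sum_boole]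
      congr 2
      ext k
      simp [and_comm]
    rw [Matrix.smul_apply, hcard, Fin.card_Iic, smul_eq_mul, of_apply, min_add_add_right, Fin.coe_min]
    push_cast
    rfl
  rw [hAA, det_smul, det_mul, det_transpose, hA, isUnit_iff_ne_zero]
  simpa using pow_ne_zero _ ha

lemma coe_gridTime (T : ℝ≥0) (N : ℕ) (i : Fin N) :
    (gridTime T N i : ℝ) = ((i : ℝ) + 1) * (T / N) := by
  simp [gridTime]

lemma gridTime_pos {T : ℝ≥0} (hT : 0 < T) {N : ℕ} (i : Fin N) : 0 < (gridTime T N i : ℝ) := by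
  have hN : 0 < N := i.pos
  rw [coe_gridTime]
  positivity

lemma gridTime_injective {T : ℝ≥0} (hT : 0 < T) {N : ℕ} :
    Function.Injective fun i => (gridTime T N i : ℝ) := by
  intro i j hij
  have hN : 0 < N := i.pos
  have hpos : (T : ℝ) / N ≠ 0 := by positivity
  simp only [coe_gridTime] at hij
  have := mul_right_cancel₀ hpos hij
  exact Fin.ext (by exact_mod_cast add_right_cancel this)

/-- The law on `ℝ ^ N` of `σ` times a Brownian motion sampled at the grid points, as an image of
the finite-dimensional distribution of Brownian motion on the finite set of grid points. -/
noncomputable def gridNoise (σ : ℝ) (T : ℝ≥0) (N : ℕ) : Measure (Fin N → ℝ) :=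
  (BrownianReal.projectiveFamily (Finset.univ.image (gridTime T N))).map
    (ContinuousLinearMap.pi fun i : Fin N =>
      σ • ContinuousLinearMap.proj (R := ℝ) (φ := fun _ => ℝ)
        (⟨gridTime T N i, by simp⟩ : Finset.univ.image (gridTime T N)))

instance (σ : ℝ) (T : ℝ≥0) (N : ℕ) : IsGaussian (gridNoise σ T N) := by
  unfold gridNoise
  infer_instance

lemma covariance_gridNoise (σ : ℝ) (T : ℝ≥0) (N : ℕ) (i j : Fin N) :
    cov[fun x => x i, fun x => x j; gridNoise σ T N]
      = (Matrix.of fun i j : Fin N =>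
          (σ ^ 2 * (T / N)) * min ((i : ℝ) + 1) ((j : ℝ) + 1)) i j := by
  rw [gridNoise, covariance_map_fun (measurable_pi_apply i).aestronglyMeasurable
    (measurable_pi_apply j).aestronglyMeasurable (by fun_prop)]
  simp only [ContinuousLinearMap.pi_apply, _root_.smul_apply, ContinuousLinearMap.proj_apply,
    smul_eq_mul]
  rw [covariance_const_mul_left, covariance_const_mul_right,
    BrownianReal.covariance_eval_projectiveFamily, NNReal.coe_min, coe_gridTime, coe_gridTime,
    ← min_mul_of_nonneg _ _ (by positivity), of_apply]
  ring

/-- The mean of the full trajectory, for the value `b = f v` of the instantaneous impact and the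
decay kernel `g`. -/
noncomputable def gridMean (S₀ b : ℝ) (g : ℝ → ℝ) (T : ℝ≥0) (N : ℕ) (i : Fin N) : ℝ :=
  S₀ + ∫ s in (0 : ℝ)..(gridTime T N i : ℝ), b * g ((gridTime T N i : ℝ) - s)

/-- The law of the full trajectory is the law of the noise translated by the mean. It depends only on
the finite-dimensional laws of the driving process, not on the probability space. -/
theorem map_fullTrajectory_propagatorPrice {Ω : Type*} [MeasurableSpace Ω] {P : Measure Ω}
    {W : ℝ≥0 → Ω → ℝ} (hW : IsPreBrownianReal W P) (S₀ σ v : ℝ) (f G : ℝ → ℝ) (T : ℝ≥0) (N : ℕ) :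
    P.map (fullTrajectory T N (propagatorPrice S₀ σ v f G W))
      = (gridNoise σ T N).map (· + gridMean S₀ (f v) G T N) := by
  have h := hW.hasLaw (Finset.univ.image (gridTime T N))
  rw [gridNoise, Measure.map_map (by fun_prop) (by fun_prop), ← h.map_eq,
    AEMeasurable.map_map_of_aemeasurable (by fun_prop) h.aemeasurable]
  congr 1
  ext ω i
  simp [fullTrajectory, propagatorPrice, gridMean, add_comm]

/-- The differences of the mean vectors span `ℝ ^ N` already when only the decay parameter varies. -/
theorem span_gridMean_sub {Γ : Set ℝ} (hΓ : ∃ U : Set ℝ, IsOpen U ∧ U.Nonempty ∧ U ⊆ Γ)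
    {G : ℝ → ℝ → ℝ}
    (hG : IsPowerLawKernel Γ G ∨ IsShiftedPowerLawKernel Γ G ∨ IsExponentialKernel Γ G)
    (S₀ : ℝ) {b : ℝ} (hb : b ≠ 0) {T : ℝ≥0} (hT : 0 < T) (N : ℕ) (γ₀ : ℝ) :
    Submodule.span ℝ ((fun γ => gridMean S₀ b (G γ) T N - gridMean S₀ b (G γ₀) T N) '' Γ) = ⊤ := by
  obtain ⟨U, hU, hne, hUΓ⟩ := hΓ
  by_contra hspan
  obtain ⟨φ, hφ0, hφ⟩ := Submodule.exists_le_ker_of_lt_top _ (lt_top_iff_ne_top.2 hspan)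
  have hsum (x : Fin N → ℝ) : φ x = ∑ i, φ (fun j => if i = j then 1 else 0) * x i := by
    rw [φ.pi_apply_eq_sum_univ x]
    simp [mul_comm]
  have hw := eq_zero_of_sum_integral_kernel_eq_const hU hne hUΓ hG (gridTime_pos hT (N := N))
    (gridTime_injective hT) hb (w := fun i => φ (fun j => if i = j then 1 else 0))
    (K := φ (gridMean S₀ b (G γ₀) T N - fun _ => S₀)) fun γ hγ => ?_
  · refine hφ0 (LinearMap.ext fun x => ?_)
    rw [hsum x, LinearMap.zero_apply]
    exact Finset.sum_eq_zero fun i _ => by rw [congrFun hw i, Pi.zero_apply, zero_mul]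
  · have h0 : φ (gridMean S₀ b (G γ) T N - gridMean S₀ b (G γ₀) T N) = 0 :=
      hφ (Submodule.subset_span ⟨γ, hUΓ hγ, rfl⟩)
    have h1 : φ (gridMean S₀ b (G γ) T N - fun _ => S₀)
        = φ (gridMean S₀ b (G γ₀) T N - fun _ => S₀) := by
      rw [← sub_eq_zero, ← map_sub, sub_sub_sub_cancel_right, h0]
    rw [← h1, hsum]
    exact Finset.sum_congr rfl fun i _ => by simp [gridMean]

end

/-! ### Minimal sufficiency of the full trajectory -/

theorem theorem2 {A : Type v} {Ω : Type w} [MeasurableSpace Ω]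
    (S₀ σ v : ℝ) (hσ : 0 < σ) (hv : 0 < v)
    (T : ℝ≥0) (hT : 0 < T) (N : ℕ) (hN : 0 < N)
    (Θf : Set A) (hΘf : Θf.Nonempty) (f : A → ℝ → ℝ)
    (hf : ∀ a ∈ Θf, ∀ x : ℝ, 0 < x → f a x ≠ 0)
    (Γ : Set ℝ) (hΓ : ∃ U : Set ℝ, IsOpen U ∧ U.Nonempty ∧ U ⊆ Γ) (G : ℝ → ℝ → ℝ)
    (hG : IsPowerLawKernel Γ G ∨ IsShiftedPowerLawKernel Γ G ∨ IsExponentialKernel Γ G)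
    (P : A × ℝ → Measure Ω) (W : A × ℝ → ℝ≥0 → Ω → ℝ)
    (hW : ∀ θ ∈ Θf ×ˢ Γ, IsBrownianReal (W θ) (P θ)) :
    IsMinimalSufficientStatistic.{u} (fullExperiment Θf Γ f G S₀ σ v T N P W)
        (fun x : Fin N → ℝ => x) ∧
      ∀ (F : Type u) [MeasurableSpace F] (Y : (Fin N → ℝ) → F), Measurable Y →
        (IsSufficientStatistic (fullExperiment Θf Γ f G S₀ σ v T N P W) Y ↔
          IsOneToOneTransform (fullExperiment Θf Γ f G S₀ σ v T N P W)
            (fun x : Fin N → ℝ => x) Y) := by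
  set m : ↥(Θf ×ˢ Γ) → Fin N → ℝ := fun θ => gridMean S₀ (f θ.1.1 v) (G θ.1.2) T N with hm
  have hQ : fullExperiment Θf Γ f G S₀ σ v T N P W = fun θ => (gridNoise σ T N).map (· + m θ) :=
    funext fun θ =>
      map_fullTrajectory_propagatorPrice (hW θ.1 θ.2).toIsPreBrownianReal S₀ σ v _ _ T N
  obtain ⟨a₀, ha₀⟩ := hΘf
  obtain ⟨γ₀, hγ₀⟩ : Γ.Nonempty := let ⟨_, _, hne, hUΓ⟩ := hΓ; hne.mono hUΓ
  let θ₀ : ↥(Θf ×ˢ Γ) := ⟨(a₀, γ₀), ha₀, hγ₀⟩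
  have hspan : Submodule.span ℝ (range fun θ => m θ - m θ₀) = ⊤ := by
    refine top_unique ((span_gridMean_sub hΓ hG S₀ (hf a₀ ha₀ v hv) hT N γ₀).ge.trans
      (Submodule.span_mono ?_))
    rintro _ ⟨γ, hγ, rfl⟩
    exact ⟨⟨(a₀, γ), ha₀, hγ⟩, rfl⟩
  have hdet := isUnit_det_min_succ N (a := σ ^ 2 * (T / N)) (by positivity)
  rw [hQ]
  have key (F : Type u) [MeasurableSpace F] (Y : (Fin N → ℝ) → F)
      (hY : IsSufficientStatistic (fun θ => (gridNoise σ T N).map (· + m θ)) Y) :=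
    hY.exists_eq_comp_of_gaussian_shift (gridNoise σ T N) hdet (covariance_gridNoise σ T N) θ₀ hspan
  refine ⟨⟨isSufficientStatistic_id, fun F _ Y hY => key F Y hY⟩, fun F _ Y hYm =>
    ⟨fun hY => ?_, fun h => h.isSufficientStatistic hYm⟩⟩
  obtain ⟨g, hg, hae⟩ := key F Y hY
  exact ⟨Y, g, hYm, hg, fun θ => (hae θ).mono fun x hx => ⟨rfl, hx⟩⟩
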